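/- Let $O_{3,2}=\mathbb{Z}+2\omega\mathbb{Z}=\mathbb{Z}[\sqrt{-3}]$, where $\omega=\frac{1+\sqrt{-3}}{2}$, and let $\Gamma_{3,2}=PSL_2(O_{3,2})$. Let $a,t,w\in\Gamma_{3,2}$ be the classes of $\begin{pmatrix}0&-1\\1&0\end{pmatrix}$, $\begin{pmatrix}1&1\\0&1\end{pmatrix}$, $\begin{pmatrix}1&\sqrt{-3}\\0&1\end{pmatrix}$, and let $K_{3,2}=\langle a,t,w^{-1}aw\rangle\le\Gamma_{3,2}$. Let $D(3,3,3)=\langle x,y\mid x^3=y^3=(xy)^3=1\rangle$, let $\alpha=(0\;1)$ and $m=(0\;1\;2)$ in the group $S_3$ of permutations of $\{0,1,2\}$ (products are composed from right to left), and let $A=S_3*_{\mathbb{Z}/3\mathbb{Z}}D(3,3,3)$ be the free product amalgamated along $m=y^{-1}$. Let $\psi$ be the automorphism of $A$ with $\psi^2=1$ given by $$\psi(\alpha)=\alpha m,\quad \psi(m)=m^{-1},\quad \psi(x)=yx,\quad \psi(y)=y^{-1},$$ and let $P=A\rtimes\mathbb{Z}/2\mathbb{Z}$, where the generator of $\mathbb{Z}/2\mathbb{Z}$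 acts on $A$ as $\psi$. Then there is a surjective homomorphism $\tau:\Gamma_{3,2}\to P$ that is injective on $K_{3,2}$. Moreover, $P$ is virtually a free product of torsion-free abelian groups and a free group, i.e. $P$ has a subgroup of finite index that is isomorphic to the free product of a family of torsion-free abelian groups and a free group. -/

import Mathlib

open scoped MatrixGroups

namespace Bianchi

/-! ### The group `Γ_{3,2} = PSL₂(O_{3,2})` and its subgroup `K_{3,2}` -/

/-- The order `O_{3,2} = ℤ + 2 ω ℤ`, `ω = (1 + √-3) / 2`, of the ring of integers of `ℚ(√-3)`.
Since `2 ω = 1 + √-3`, this is the ring of the numbers `x + y √-3` with `x, y ∈ ℤ`. -/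
abbrev O32 : Type := ℤ√(-3)

/-- `Γ_{3,2} = PSL₂(O_{3,2})`, the quotient of `SL₂(O_{3,2})` by its centre `{1, -1}`. -/
abbrev Gamma32 : Type := PSL(2, O32)

/-- The class in `Γ_{3,2}` of a matrix of determinant one with entries in `O_{3,2}`. -/
def toGamma (A : Matrix (Fin 2) (Fin 2) O32) (hA : A.det = 1) : Gamma32 :=
  QuotientGroup.mk (⟨A, hA⟩ : Matrix.SpecialLinearGroup (Fin 2) O32)

/-- The element `a`, that is `z ↦ -1 / z`. -/
def aElt : Gamma32 := toGamma !![0, -1; 1, 0] (by simp [Matrix.det_fin_two])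

/-- The element `t`, that is `z ↦ z + 1`. -/
def tElt : Gamma32 := toGamma !![1, 1; 0, 1] (by simp [Matrix.det_fin_two])

/-- The element `w`, that is `z ↦ z + √-3`. -/
def wElt : Gamma32 := toGamma !![1, Zsqrtd.sqrtd; 0, 1] (by simp [Matrix.det_fin_two])

/-- The subgroup `K_{3,2} = ⟨a, t, v⟩` of `Γ_{3,2}`, where `v = w⁻¹ a w`. It is the base group of
the HNN-decomposition of `Γ_{3,2}` with stable letter `w` and associated subgroups
`⟨a, t⟩` and `⟨v, t⟩`. -/
def K32 : Subgroup Gamma32 := Subgroup.closure {aElt, tElt, wElt⁻¹ * aElt * wElt}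

/-! ### The amalgam `S₃ *_{ℤ/3} D(3,3,3)` -/

/-- The relators `x³, y³, (xy)³`. -/
def triangleRels : Set (FreeGroup (Fin 2)) :=
  {FreeGroup.of 0 ^ 3, FreeGroup.of 1 ^ 3, (FreeGroup.of 0 * FreeGroup.of 1) ^ 3}

/-- `D(3,3,3) = ⟨x, y | x³ = y³ = (xy)³ = 1⟩`. -/
abbrev D333 : Type := PresentedGroup triangleRels

/-- The generator `x` of `D(3,3,3)`. -/
def dx : D333 := PresentedGroup.of 0

/-- The generator `y` of `D(3,3,3)`. -/
def dy : D333 := PresentedGroup.of 1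

theorem dx_pow : dx ^ 3 = 1 :=
  PresentedGroup.one_of_mem (rels := triangleRels) (by simp [triangleRels])

theorem dy_pow : dy ^ 3 = 1 :=
  PresentedGroup.one_of_mem (rels := triangleRels) (by simp [triangleRels])

theorem dxy_pow : (dx * dy) ^ 3 = 1 :=
  PresentedGroup.one_of_mem (rels := triangleRels) (by simp [triangleRels])

/-- The symmetric group `S₃`. -/
abbrev S3 : Type := Equiv.Perm (Fin 3)

/-- The transposition `a = (0 1)` of `S₃`. -/
def sa : S3 := Equiv.swap 0 1

/-- The 3-cycle `m = (0 1 2)` of `S₃`. -/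
def sm : S3 := finRotate 3

/-- The cyclic group of order 3, written multiplicatively. -/
abbrev C3 : Type := Multiplicative (ZMod 3)

/-- The homomorphism from the cyclic group of order `n` that sends the generator to `g`,
where `g ^ n = 1`. -/
def zmodHom {G : Type*} [Group G] (n : ℕ) (g : G) (hg : g ^ n = 1) :
    Multiplicative (ZMod n) →* G :=
  AddMonoidHom.toMultiplicativeLeft
    (ZMod.lift n ⟨(zmultiplesHom (Additive G)) (Additive.ofMul g), by
      simp [← ofMul_pow, hg]⟩)

theorem zmodHom_gen {G : Type*} [Group G] (n : ℕ) (g : G) (hg : g ^ n = 1) :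
    zmodHom n g hg (Multiplicative.ofAdd 1) = g := by
  have h := ZMod.lift_coe n (⟨(zmultiplesHom (Additive G)) (Additive.ofMul g), by
      simp [← ofMul_pow, hg]⟩ : { f : ℤ →+ Additive G // f n = 0 }) 1
  simp only [Int.cast_one] at h
  change Additive.toMul (ZMod.lift n _ 1) = g
  rw [h]
  simp

theorem zmod_hom_ext {G : Type*} [Group G] {n : ℕ} {f g : Multiplicative (ZMod n) →* G}
    (h : f (Multiplicative.ofAdd 1) = g (Multiplicative.ofAdd 1)) : f = g := by
  refine MonoidHom.ext fun z => ?_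
  obtain ⟨k, hk⟩ := ZMod.intCast_surjective z.toAdd
  have hz : z = Multiplicative.ofAdd (1 : ZMod n) ^ k := by
    rw [← ofAdd_zsmul, zsmul_one, hk, ofAdd_toAdd]
  rw [hz, map_zpow, map_zpow, h]

/-- The two factors of the amalgam. -/
def Factor : Bool → Type
  | false => S3
  | true => D333

instance instGroupFactor : ∀ i, Group (Factor i)
  | false => inferInstanceAs (Group S3)
  | true => inferInstanceAs (Group D333)

theorem sm_pow : sm ^ 3 = 1 := by
  unfold sm
  decide

theorem dy_inv_pow : dy⁻¹ ^ 3 = 1 := by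
  rw [inv_pow, dy_pow, inv_one]

/-- The embedding of the cyclic group of order 3 in `S₃` with generator `↦ m`. -/
def c3ToS : C3 →* S3 := zmodHom 3 sm sm_pow

/-- The embedding of the cyclic group of order 3 in `D(3,3,3)` with generator `↦ m̄ = y⁻¹`. -/
def c3ToD : C3 →* D333 := zmodHom 3 dy⁻¹ dy_inv_pow

/-- The two embeddings of the amalgamated subgroup as a family. -/
def amalgMap : ∀ i, C3 →* Factor i
  | false => c3ToS
  | true => c3ToD

/-- The amalgamated free product `S₃ *_{ℤ/3} D(3,3,3)`. -/
abbrev Amalgam : Type := Monoid.PushoutI amalgMap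

/-- The inclusion of `S₃` in the amalgam. -/
def inS : S3 →* Amalgam := Monoid.PushoutI.of (φ := amalgMap) false

/-- The inclusion of `D(3,3,3)` in the amalgam. -/
def inD : D333 →* Amalgam := Monoid.PushoutI.of (φ := amalgMap) true

theorem inS_sm : inS sm = inD dy⁻¹ := by
  have h1 := Monoid.PushoutI.of_apply_eq_base amalgMap false (Multiplicative.ofAdd 1)
  have h2 := Monoid.PushoutI.of_apply_eq_base amalgMap true (Multiplicative.ofAdd 1)
  have e1 : c3ToS (Multiplicative.ofAdd 1) = sm := zmodHom_gen 3 sm sm_pow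
  have e2 : c3ToD (Multiplicative.ofAdd 1) = dy⁻¹ := zmodHom_gen 3 dy⁻¹ dy_inv_pow
  rw [← e1, ← e2]
  exact h1.trans h2.symm

theorem amalgam_hom_ext {G : Type*} [Group G] {f g : Amalgam →* G}
    (ha : f (inS sa) = g (inS sa)) (hx : f (inD dx) = g (inD dx))
    (hy : f (inD dy) = g (inD dy)) : f = g := by
  have hm : f (inS sm) = g (inS sm) := by rw [inS_sm, map_inv, map_inv, map_inv, hy]
  have hS : f.comp inS = g.comp inS := by
    ext p
    have key : ∀ p : S3, ∃ i : Fin 2, ∃ j : Fin 3, p = sa ^ (i : ℕ) * sm ^ (j : ℕ) := by decide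
    obtain ⟨i, j, rfl⟩ := key p
    simp [ha, hm]
  have hD : f.comp inD = g.comp inD := by
    apply PresentedGroup.ext
    intro i
    fin_cases i
    · exact hx
    · exact hy
  apply Monoid.PushoutI.hom_ext_nonempty
  intro i
  cases i
  · exact hS
  · exact hD

/-! ### The automorphism `ψ` of order 2 of the amalgam -/

/-- The automorphism `ψ₁` of `S₃` with `a ↦ am` and `m ↦ m⁻¹`. -/
def psiS : S3 →* S3 := (MulAut.conj (sa * sm⁻¹)).toMonoidHom

theorem psiS_sa : psiS sa = sa * sm := by decide

theorem psiS_sm : psiS sm = sm⁻¹ := by decide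

/-- The endomorphism `ψ₂` of `D(3,3,3)` with `x ↦ y x` and `y ↦ y⁻¹`. -/
def psiD : D333 →* D333 :=
  PresentedGroup.toGroup (rels := triangleRels) (f := ![dy * dx, dy⁻¹]) (by
    have conj3 : ∀ g h : D333, (g * h * g⁻¹) ^ 3 = g * h ^ 3 * g⁻¹ := fun g h => conj_pow
    rintro r (rfl | rfl | rfl)
    · have h := conj3 dy (dx * dy)
      rw [dxy_pow] at h
      simpa [mul_assoc] using h
    · simp [dy_pow]
    · have h := conj3 dy dx
      rw [dx_pow] at h
      simpa using h)

theorem psiD_dx : psiD dx = dy * dx := by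
  simp [psiD, dx]

theorem psiD_dy : psiD dy = dy⁻¹ := by
  simp [psiD, dy]

/-- The endomorphisms `ψ₁` and `ψ₂`, followed by the inclusions in the amalgam. -/
def psiFactor : ∀ i, Factor i →* Amalgam
  | false => inS.comp psiS
  | true => inD.comp psiD

theorem psi_compat : (inD.comp psiD).comp c3ToD = (inS.comp psiS).comp c3ToS := by
  apply zmod_hom_ext
  have e1 : c3ToS (Multiplicative.ofAdd 1) = sm := zmodHom_gen 3 sm sm_pow
  have e2 : c3ToD (Multiplicative.ofAdd 1) = dy⁻¹ := zmodHom_gen 3 dy⁻¹ dy_inv_pow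
  simp only [MonoidHom.comp_apply, e1, e2]
  rw [psiS_sm, map_inv, map_inv, map_inv, psiD_dy, inS_sm]

/-- The endomorphism of the amalgam that extends `ψ₁` and `ψ₂`. -/
def psiHom : Amalgam →* Amalgam :=
  Monoid.PushoutI.lift psiFactor ((inS.comp psiS).comp c3ToS) (by
    intro i
    cases i
    · rfl
    · exact psi_compat)

theorem psiHom_inS (p : S3) : psiHom (inS p) = inS (psiS p) :=
  Monoid.PushoutI.lift_of (φ := amalgMap) psiFactor _ _ (i := false) p

theorem psiHom_inD (d : D333) : psiHom (inD d) = inD (psiD d) :=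
  Monoid.PushoutI.lift_of (φ := amalgMap) psiFactor _ _ (i := true) d

theorem psiHom_comp_self : psiHom.comp psiHom = MonoidHom.id Amalgam := by
  apply amalgam_hom_ext
  · have h : psiS (psiS sa) = sa := by decide
    simp [psiHom_inS, h]
  · simp [psiHom_inD, psiD_dx, psiD_dy]
  · simp [psiHom_inD, psiD_dy]

/-- The automorphism `ψ` of the amalgam with `a ↦ am`, `m ↦ m⁻¹`, `x ↦ y x`, `y ↦ y⁻¹`. -/
def psi : MulAut Amalgam :=
  MonoidHom.toMulEquiv psiHom psiHom psiHom_comp_self psiHom_comp_self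

theorem psi_sq : psi ^ 2 = 1 := by
  ext z
  exact DFunLike.congr_fun psiHom_comp_self z

/-! ### The group `P` -/

/-- `P = (S₃ *_{ℤ/3} D(3,3,3)) ⋊ ℤ/2`, the generator of `ℤ/2` acting by `ψ`. -/
abbrev P : Type := Amalgam ⋊[zmodHom 2 psi psi_sq] Multiplicative (ZMod 2)

/-- A group is virtually a free product of torsion-free abelian groups and a free group if it has
a subgroup of finite index that is isomorphic to such a free product. -/
def IsVirtuallyFreeProduct (G : Type) [Group G] : Prop :=
  ∃ H : Subgroup G, H.FiniteIndex ∧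
    ∃ (ι : Type) (A : ι → Type) (_ : ∀ i, CommGroup (A i)) (X : Type),
      (∀ i, IsMulTorsionFree (A i)) ∧
      Nonempty (H ≃* Monoid.Coprod (Monoid.CoprodI A) (FreeGroup X))

end Bianchi

namespace Bianchi

/-! ### A presentation of `SL₂(ℤ[√-3])` modulo `-1` -/

/-! The group `Gamma32` is presented by `α² = [t, w] = (αt)³ = (α·wαw⁻¹)³ = 1`. What is needed is
that a triple with these relations in any group `G` (a `RelTriple`) yields a homomorphism `Gamma32
→* G`. The Euclidean algorithm on the first column of a matrix writes it as a word in the generators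
and so gives a value in `G`. `Compat.peak` shows that two ways to reduce the same matrix give the
same value, whence `compat`, and multiplicativity (`eval_mul`) follows.

In `P` the elements `α`, `αx` and the generator of `ℤ/2` form such a triple: this gives `tau`.
Conversely the relations in `Gamma32` give a homomorphism from the amalgam to `Gamma32` whose range
contains `K32`, and its composition with `tau` is the inclusion of the amalgam in `P`. Hence `tau`
is injective on `K32`, and its image contains both factors of the semidirect product. No normal form
in the amalgam is needed.

For the last claim, `D(3,3,3)` is the `A₂` root lattice extended by a rotation of order 3, so that
the amalgam is `(L * L) ⋊ S₃`, with odd permutations exchanging the two copies of the lattice `L`.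
The group `L * L` is the kernel of a map to `S₃`, so it has finite index in `P`; the free group
factor is trivial. -/

theorem norm_eq (z : O32) : z.norm = z.re ^ 2 + 3 * z.im ^ 2 := by
  rw [Zsqrtd.norm_def]; ring

theorem norm_nonneg (z : O32) : 0 ≤ z.norm := by
  rw [norm_eq]; positivity

theorem norm_pos {z : O32} (hz : z ≠ 0) : 0 < z.norm := by
  rw [norm_eq]
  by_contra! h
  apply hz
  have h1 : z.re ^ 2 = 0 := by nlinarith [sq_nonneg z.re, sq_nonneg z.im]
  have h2 : z.im ^ 2 = 0 := by nlinarith [sq_nonneg z.re, sq_nonneg z.im]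
  exact Zsqrtd.ext (by simpa using h1) (by simpa using h2)

/-- The translation matrix `!![1, z; 0, 1]`. -/
def transl (z : O32) : SL(2, O32) := ⟨!![1, z; 0, 1], by simp [Matrix.det_fin_two]⟩

theorem transl_coe (z : O32) : (transl z : Matrix (Fin 2) (Fin 2) O32) = !![1, z; 0, 1] := rfl

/-- The inversion matrix `!![0, -1; 1, 0]`. -/
def inver : SL(2, O32) := ⟨!![0, -1; 1, 0], by simp [Matrix.det_fin_two]⟩

/-! ### Left multiplication by the generators and the matrix forms of the relations. -/

section entries
variable (z : O32) (M : SL(2, O32))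

@[simp] theorem transl_mul_zero (j : Fin 2) : (transl z * M) 0 j = M 0 j + z * M 1 j := by
  change ((!![1, z; 0, 1] : Matrix (Fin 2) (Fin 2) O32) * (M : Matrix (Fin 2) (Fin 2) O32)) 0 j = _
  simp [Matrix.mul_apply, Fin.sum_univ_two]

@[simp] theorem transl_mul_one (j : Fin 2) : (transl z * M) 1 j = M 1 j := by
  change ((!![1, z; 0, 1] : Matrix (Fin 2) (Fin 2) O32) * (M : Matrix (Fin 2) (Fin 2) O32)) 1 j = _
  simp [Matrix.mul_apply, Fin.sum_univ_two]

@[simp] theorem inver_mul_zero (j : Fin 2) : (inver * M) 0 j = -M 1 j := by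
  change ((!![0, -1; 1, 0] : Matrix (Fin 2) (Fin 2) O32) * (M : Matrix (Fin 2) (Fin 2) O32)) 0 j = _
  simp [Matrix.mul_apply, Fin.sum_univ_two]

@[simp] theorem inver_mul_one (j : Fin 2) : (inver * M) 1 j = M 0 j := by
  change ((!![0, -1; 1, 0] : Matrix (Fin 2) (Fin 2) O32) * (M : Matrix (Fin 2) (Fin 2) O32)) 1 j = _
  simp [Matrix.mul_apply, Fin.sum_univ_two]

end entries

theorem sl_ext {M N : SL(2, O32)} (h0 : ∀ j, M 0 j = N 0 j) (h1 : ∀ j, M 1 j = N 1 j) :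
    M = N := by
  refine Matrix.SpecialLinearGroup.ext _ _ fun i j => ?_
  fin_cases i
  · exact h0 j
  · exact h1 j

theorem neg_entry (M : SL(2, O32)) (i j : Fin 2) : (-M) i j = -M i j := by
  simp

theorem det_eq (M : SL(2, O32)) : M 0 0 * M 1 1 - M 0 1 * M 1 0 = 1 := by
  rw [← Matrix.det_fin_two]; exact M.det_coe

theorem transl_transl (y z : O32) (M : SL(2, O32)) :
    transl y * (transl z * M) = transl (y + z) * M := by
  apply sl_ext <;> intro j <;> simp; ring

theorem transl_zero : transl 0 = 1 := by
  apply sl_ext <;> intro j <;> fin_cases j <;> simp [transl]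

theorem inver_inver (M : SL(2, O32)) : inver * (inver * M) = -M := by
  apply sl_ext <;> intro j <;> simp

theorem inver_transl_inver {d : O32} (hd : d = 1 ∨ d = -1) (M : SL(2, O32)) :
    inver * (transl (-d) * (inver * M)) = transl d * (inver * (transl d * M)) ∨
      inver * (transl (-d) * (inver * M)) = -(transl d * (inver * (transl d * M))) := by
  rcases hd with rfl | rfl
  · right
    apply sl_ext <;> intro j <;> simp only [neg_entry, transl_mul_zero, transl_mul_one,
      inver_mul_zero, inver_mul_one] <;> ring
  · left
    apply sl_ext <;> intro j <;> simp only [transl_mul_zero, transl_mul_one,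
      inver_mul_zero, inver_mul_one] <;> ring

/-- The relation `(α·wαw⁻¹)³ = 1`, written as the equality of two half-turns around a hexagon; it
holds in `SL₂` without a sign. -/
theorem hexagon {d : O32} (hd : d * d = -3) (M : SL(2, O32)) :
    inver * (transl d * (inver * (transl (-d) * (inver * (transl d * M))))) =
      transl d * (inver * (transl (-d) * (inver * (transl d * (inver * M))))) := by
  apply sl_ext <;> intro j <;> simp only [transl_mul_zero, transl_mul_one,
    inver_mul_zero, inver_mul_one]
  · linear_combination d * M 0 j * hd
  · linear_combination -d * M 1 j * hd

/-- The norm of the lower left entry. -/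
def size (M : SL(2, O32)) : ℕ := (M 1 0).norm.natAbs

/-! ### Euclidean reduction of the lower left entry. -/

theorem size_cast (M : SL(2, O32)) : (size M : ℤ) = (M 1 0).norm :=
  Int.natAbs_of_nonneg (norm_nonneg _)

theorem size_lt {M N : SL(2, O32)} : size M < size N ↔ (M 1 0).norm < (N 1 0).norm := by
  rw [← size_cast, ← size_cast, Nat.cast_lt]

theorem size_transl (z : O32) (M : SL(2, O32)) : size (transl z * M) = size M := by
  simp [size]

theorem size_neg (M : SL(2, O32)) : size (-M) = size M := by
  simp [size]

/-- The ring is not Euclidean: rounding both coordinates of a quotient only bounds the norm of the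
error by `1/4 + 3/4 = 1`. Equality forces the norms of `c` and of the remainder `p` to be even. Then
both lie in the ideal of the `z` with `z.re + z.im` even, which is impossible because they form a
column of determinant one. -/
theorem exists_reduction (M : SL(2, O32)) (h : M 1 0 ≠ 0) :
    ∃ q : O32, (M 0 0 - q * M 1 0).norm < (M 1 0).norm := by
  set c := M 1 0 with hc
  have hn := norm_pos h
  set n := c.norm with hndef
  set u := M 0 0 * star c with hu
  obtain ⟨k, hk⟩ : ∃ k : ℤ, |2 * (u.re - k * n)| ≤ n := by
    -- The integer nearest to `u.re / n`.
    refine ⟨(2 * u.re + n) / (2 * n), ?_⟩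
    have h1 := Int.emod_add_mul_ediv (2 * u.re + n) (2 * n)
    have h2 := Int.emod_nonneg (2 * u.re + n) (show 2 * n ≠ 0 by omega)
    have h3 := Int.emod_lt_of_pos (2 * u.re + n) (show 0 < 2 * n by omega)
    rw [abs_le]; constructor <;> nlinarith
  obtain ⟨l, hl⟩ : ∃ k : ℤ, |2 * (u.im - k * n)| ≤ n := by
    refine ⟨(2 * u.im + n) / (2 * n), ?_⟩
    have h1 := Int.emod_add_mul_ediv (2 * u.im + n) (2 * n)
    have h2 := Int.emod_nonneg (2 * u.im + n) (show 2 * n ≠ 0 by omega)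
    have h3 := Int.emod_lt_of_pos (2 * u.im + n) (show 0 < 2 * n by omega)
    rw [abs_le]; constructor <;> nlinarith
  refine ⟨⟨k, l⟩, ?_⟩
  set p := M 0 0 - ⟨k, l⟩ * c with hp
  have hpc : p * star c = ⟨u.re - k * n, u.im - l * n⟩ := by
    have : p * star c = u - ⟨k, l⟩ * (n : O32) := by
      rw [hp, hu, hndef, Zsqrtd.norm_eq_mul_conj]; ring
    rw [this]; ext <;> simp
  have hnorm : p.norm * n = (u.re - k * n) ^ 2 + 3 * (u.im - l * n) ^ 2 := by
    have := congrArg Zsqrtd.norm hpc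
    rw [Zsqrtd.norm_mul, Zsqrtd.norm_conj, ← hndef, norm_eq (Zsqrtd.mk (u.re - k * n) (u.im - l * n))] at this
    exact this
  have hk2 := sq_le_sq' (abs_le.1 hk).1 (abs_le.1 hk).2
  have hl2 := sq_le_sq' (abs_le.1 hl).1 (abs_le.1 hl).2
  by_contra! hle
  have hmul : n * n ≤ p.norm * n := by nlinarith
  have hpn : p.norm = n := by nlinarith
  have hkn : (2 * (u.re - k * n)) ^ 2 = n ^ 2 := by nlinarith
  have hneven : Even n := by
    have : Even (n ^ 2) := by rw [← hkn]; exact ⟨2 * (u.re - k * n) ^ 2, by ring⟩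
    exact (Int.even_pow.1 this).1
  have par : ∀ z : O32, Even z.norm → Even (z.re + z.im) := by
    intro z hz
    rw [norm_eq] at hz
    simpa [Int.even_add, Int.even_mul, Int.even_pow, show ¬ Even (3 : ℤ) by decide] using hz
  have hcp := par c hneven
  have hpp := par p (hpn ▸ hneven)
  have hdet : p * M 1 1 - (M 0 1 - ⟨k, l⟩ * M 1 1) * c = 1 := by
    have := det_eq M
    rw [hp]
    linear_combination this
  have h1 := congrArg Zsqrtd.re hdet
  have h2 := congrArg Zsqrtd.im hdet
  generalize M 0 1 - ⟨k, l⟩ * M 1 1 = b at *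
  simp only [Zsqrtd.re_sub, Zsqrtd.im_sub, Zsqrtd.re_mul, Zsqrtd.im_mul, Zsqrtd.re_one,
    Zsqrtd.im_one] at h1 h2
  obtain ⟨i, hi⟩ := hcp
  obtain ⟨j, hj⟩ := hpp
  have hc' : c.im = 2 * i - c.re := by omega
  have hp' : p.im = 2 * j - p.re := by omega
  rw [hc', hp'] at h1 h2
  -- The sum of the real and imaginary parts of the determinant equation, which is even on the left.
  have h : 2 * (j * (M 1 1).re - 3 * j * (M 1 1).im + 2 * p.re * (M 1 1).im
      - (i * b.re - 3 * i * b.im + 2 * c.re * b.im)) = 1 := by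
    linear_combination h1 + h2
  omega

/-- Three elements of a group that satisfy the defining relations of `PSL₂(ℤ[√-3])`. -/
structure RelTriple (G : Type*) [Group G] where
  α : G
  t : G
  w : G
  α_mul : α * α = 1
  comm : Commute t w
  rel_t : (α * t) ^ 3 = 1
  rel_w : (α * (w * α * w⁻¹)) ^ 3 = 1

/-! ### Consequences of the relations, and evaluation by the Euclidean algorithm. -/

namespace RelTriple

variable {G : Type*} [Group G] (D : RelTriple G)

/-- The image of the translation by `z`. -/
def tr (z : O32) : G := D.t ^ z.re * D.w ^ z.im

theorem tr_add (y z : O32) : D.tr (y + z) = D.tr y * D.tr z := by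
  have h : D.w ^ y.im * D.t ^ z.re = D.t ^ z.re * D.w ^ y.im :=
    ((D.comm.zpow_zpow z.re y.im).eq).symm
  simp only [tr, Zsqrtd.re_add, Zsqrtd.im_add, zpow_add]
  simp only [mul_assoc]
  rw [← mul_assoc (D.w ^ y.im), h, mul_assoc]

theorem tr_zero : D.tr 0 = 1 := by simp [tr]

theorem tr_neg (z : O32) : D.tr (-z) = (D.tr z)⁻¹ := by
  rw [eq_inv_iff_mul_eq_one, ← tr_add, neg_add_cancel, tr_zero]

theorem tr_one : D.tr 1 = D.t := by simp [tr]

theorem tr_sqrtd : D.tr Zsqrtd.sqrtd = D.w := by simp [tr]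

theorem α_inv : D.α⁻¹ = D.α := inv_eq_of_mul_eq_one_left D.α_mul

theorem α_α_mul (g : G) : D.α * (D.α * g) = g := by rw [← mul_assoc, D.α_mul, one_mul]

theorem braid_unit {d : O32} (hd : d = 1 ∨ d = -1) :
    D.α * (D.tr (-d) * D.α) = D.tr d * (D.α * D.tr d) := by
  have h : D.t * (D.α * D.t) = D.α * D.t⁻¹ * D.α := by
    have := D.rel_t
    rw [pow_succ, sq, mul_eq_one_iff_eq_inv] at this
    have := congrArg (D.α * ·) this
    simpa only [mul_inv_rev, D.α_inv, mul_assoc, D.α_α_mul] using this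
  rcases hd with rfl | rfl
  · simp [tr_neg, tr_one, h, mul_assoc]
  · have h2 := congrArg (·⁻¹) h
    simp only [mul_inv_rev, inv_inv, D.α_inv, mul_assoc] at h2
    simp [tr_neg, tr_one, h2]

theorem braid_of_pow {a v : G} (ha : a * a = 1) (hv : v * v = 1) (h : (a * v) ^ 3 = 1) :
    a * v * a = v * a * v := by
  have ha' : a⁻¹ = a := inv_eq_of_mul_eq_one_left ha
  have hv' : v⁻¹ = v := inv_eq_of_mul_eq_one_left hv
  rw [← mul_inv_eq_one]
  simpa [ha', hv', mul_assoc, pow_succ] using h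

/-- Conjugation by `α w⁻¹` shows that the relation is symmetric under `w ↦ w⁻¹`. -/
theorem rel_w_inv : (D.α * (D.w⁻¹ * D.α * D.w)) ^ 3 = 1 := by
  have h : D.α * (D.w⁻¹ * D.α * D.w) =
      (D.α * D.w⁻¹) * (D.α * (D.w * D.α * D.w⁻¹)) * (D.α * D.w⁻¹)⁻¹ := by
    simp [mul_assoc, D.α_inv, D.α_mul]
  rw [h, conj_pow, D.rel_w, mul_one, mul_inv_cancel]

theorem braid_sqrtd {d : O32} (hd : d = Zsqrtd.sqrtd ∨ d = -Zsqrtd.sqrtd) :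
    D.α * (D.tr d * (D.α * (D.tr (-d) * (D.α * D.tr d)))) =
      D.tr d * (D.α * (D.tr (-d) * (D.α * (D.tr d * D.α)))) := by
  have key : ∀ g : G, (D.α * (g * D.α * g⁻¹)) ^ 3 = 1 →
      D.α * (g * (D.α * (g⁻¹ * (D.α * g)))) = g * (D.α * (g⁻¹ * (D.α * (g * D.α)))) := by
    intro g hg
    have := braid_of_pow D.α_mul (v := g * D.α * g⁻¹) (by simp [mul_assoc, D.α_α_mul]) hg
    have := congrArg (· * g) this
    simpa [mul_assoc] using this
  rw [tr_neg]
  apply key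
  rcases hd with rfl | rfl
  · rw [tr_sqrtd]; exact D.rel_w
  · rw [tr_neg, tr_sqrtd, inv_inv]
    exact D.rel_w_inv

/-- A translation that moves the image of the cusp close to `0`. -/
noncomputable def shift (M : SL(2, O32)) : O32 :=
  Classical.epsilon fun q : O32 => (M 0 0 - q * M 1 0).norm < (M 1 0).norm

theorem shift_spec {M : SL(2, O32)} (h : M 1 0 ≠ 0) :
    (M 0 0 - shift M * M 1 0).norm < (M 1 0).norm :=
  Classical.epsilon_spec (exists_reduction M h)

/-- The predicates for `M` and `-M` are equal, so `Classical.epsilon` picks the same element. -/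
theorem shift_neg (M : SL(2, O32)) : shift (-M) = shift M := by
  unfold shift
  congr 1
  funext q
  rw [neg_entry, neg_entry, Zsqrtd.norm_neg, mul_neg, ← neg_sub', Zsqrtd.norm_neg]

theorem size_reduce (M : SL(2, O32)) (q : O32)
    (h : (M 0 0 - q * M 1 0).norm < (M 1 0).norm) :
    size (inver * (transl (-q) * M)) < size M := by
  rw [size_lt]
  simpa [sub_eq_add_neg] using h

/-- The map to `G` that is determined by the Euclidean algorithm. -/
noncomputable def eval (M : SL(2, O32)) : G :=
  if _h : M 1 0 = 0 then D.tr (M 0 0 * M 0 1)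
  else D.tr (shift M) * (D.α * eval (inver * (transl (-shift M) * M)))
termination_by size M
decreasing_by exact size_reduce M _ (shift_spec ‹_›)

/-- Here `M` is plus or minus a translation, and the product `M 0 0 * M 0 1` is the translation
length for either sign. -/
theorem eval_zero {M : SL(2, O32)} (h : M 1 0 = 0) : D.eval M = D.tr (M 0 0 * M 0 1) := by
  rw [eval, dif_pos h]

theorem eval_ne {M : SL(2, O32)} (h : M 1 0 ≠ 0) :
    D.eval M = D.tr (shift M) * (D.α * D.eval (inver * (transl (-shift M) * M))) := by
  rw [eval, dif_neg h]

theorem eval_neg (M : SL(2, O32)) : D.eval (-M) = D.eval M := by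
  induction hn : size M using Nat.strong_induction_on generalizing M with
  | _ n ih =>
    by_cases h : M 1 0 = 0
    · rw [eval_zero _ h, eval_zero _ (by rw [neg_entry, h, neg_zero]), neg_entry, neg_entry,
        neg_mul_neg]
    · have h' : (-M) 1 0 ≠ 0 := by rwa [neg_entry, neg_ne_zero]
      rw [eval_ne _ h, eval_ne _ h', shift_neg]
      have : inver * (transl (-shift M) * -M) = -(inver * (transl (-shift M) * M)) := by
        rw [mul_neg, mul_neg]
      rw [this, ih _ (hn ▸ size_reduce M _ (shift_spec h)) _ rfl]

/-- Compatibility of `eval` with translations and inversion on matrices of size less than `n`. -/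
def Compat (n : ℕ) : Prop :=
  (∀ z M, size M < n → D.eval (transl z * M) = D.tr z * D.eval M) ∧
    ∀ M, size M < n → size (inver * M) < n → D.eval (inver * M) = D.α * D.eval M

theorem eq_of_norm_lt_four {d : O32} (h : d.norm < 4) (hd : d ≠ 0) :
    (d = 1 ∨ d = -1) ∨ (d = Zsqrtd.sqrtd ∨ d = -Zsqrtd.sqrtd) := by
  rw [norm_eq] at h
  have h1 : d.im ^ 2 < 2 := by nlinarith [sq_nonneg d.re]
  have h2 : d.re ^ 2 < 4 := by nlinarith [sq_nonneg d.im]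
  obtain ⟨x, y⟩ := d
  simp only at *
  have hx : -2 < x ∧ x < 2 := by constructor <;> nlinarith
  have hy : -2 < y ∧ y < 2 := by constructor <;> nlinarith
  obtain ⟨hx1, hx2⟩ := hx
  obtain ⟨hy1, hy2⟩ := hy
  interval_cases x <;> interval_cases y <;> first | (exfalso; revert h; decide) | skip
  all_goals revert hd; decide

/-- Two reducing translations differ by a small `d`, by the parallelogram inequality; only `±1` and
`±√-3` remain. -/
theorem norm_lt_four {p c d : O32} (h1 : p.norm ≤ c.norm) (h2 : (p + d * c).norm < c.norm) :
    d.norm < 4 := by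
  have h : (d * c).norm ≤ 2 * (p + d * c).norm + 2 * p.norm := by
    rw [norm_eq, norm_eq, norm_eq]
    simp only [Zsqrtd.re_add, Zsqrtd.im_add]
    nlinarith [sq_nonneg (2 * p.re + (d * c).re), sq_nonneg (2 * p.im + (d * c).im)]
  rw [Zsqrtd.norm_mul] at h
  have := norm_nonneg c
  nlinarith

/-- The point `p / c` lies in the thin lens between the unit circles around `0` and `-d`. The three
bounds say that the other vertices of the hexagon are smaller than the top. -/
theorem norm_hexagon {p c d : O32} (hd : d = Zsqrtd.sqrtd ∨ d = -Zsqrtd.sqrtd)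
    (h1 : p.norm ≤ c.norm) (h2 : (p + d * c).norm < c.norm) :
    (2 * p + d * c).norm < c.norm ∧ (d * p - c).norm < c.norm ∧
      (2 * c - d * p).norm < c.norm := by
  rcases hd with rfl | rfl <;> simp [norm_eq] at * <;> refine ⟨?_, ?_, ?_⟩ <;> nlinarith

/-! ### Independence of the evaluation from the choices. -/

variable {D}

/-- Peak reduction: the two ways down from `M`, by `inver` and by `inver` after `transl d`, are
joined by a path of matrices of size less than `n`. The relation `(αt)³ = 1` supplies it if `d =
±1`, and the hexagon if `d = ±√-3`. The hypothesis `H` stays abstract because `inver * M` may itself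
have size `n`. -/
theorem Compat.peak {n : ℕ} (ih : D.Compat n) {M : SL(2, O32)} (hM : size M = n)
    {d : O32} (h0 : d ≠ 0) (h1 : (M 0 0).norm ≤ (M 1 0).norm)
    (h2 : (M 0 0 + d * M 1 0).norm < (M 1 0).norm)
    (H : ∀ q, size (inver * (transl (-q) * (inver * M))) < n →
      D.eval (inver * M) = D.tr q * (D.α * D.eval (inver * (transl (-q) * (inver * M))))) :
    D.α * D.eval (inver * M) = D.tr (-d) * (D.α * D.eval (inver * (transl d * M))) := by
  have small : ∀ N : SL(2, O32), size N < n ↔ (N 1 0).norm < (M 1 0).norm := by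
    intro N; rw [← hM, size_lt]
  rcases eq_of_norm_lt_four (norm_lt_four h1 h2) h0 with hd | hd
  · have hs : size (inver * (transl d * M)) < n := by
      rw [small]; simpa using h2
    have hE : D.eval (inver * (transl (-d) * (inver * M))) =
        D.tr d * D.eval (inver * (transl d * M)) := by
      rw [← ih.1 _ _ hs]
      rcases inver_transl_inver hd M with h | h <;> rw [h]
      rw [eval_neg]
    have hs' : size (inver * (transl (-d) * (inver * M))) < n := by
      rcases inver_transl_inver hd M with h | h <;> rw [h]
      · rwa [size_transl]
      · rwa [size_neg, size_transl]
    rw [H d hs', hE]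
    have h := congrArg (D.α * · * D.eval (inver * (transl d * M))) (D.braid_unit hd)
    simp only [mul_assoc, D.α_α_mul] at h
    rw [h]
  · obtain ⟨e1, e2, e3⟩ := norm_hexagon hd h1 h2
    have hdd : d * d = -3 := by rcases hd with rfl | rfl <;> decide
    have hd' : -d = Zsqrtd.sqrtd ∨ -d = -Zsqrtd.sqrtd := by
      rcases hd with rfl | rfl
      · exact Or.inr rfl
      · exact Or.inl (neg_neg _)
    set M₁ := inver * (transl d * M) with hM₁
    set M₂ := inver * (transl d * (inver * M)) with hM₂
    have s1 : size M₁ < n := by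
      rw [small]; simpa [hM₁] using h2
    have s2 : size M₂ < n := by
      rw [small]
      have : M₂ 1 0 = d * M 0 0 - M 1 0 := by simp [hM₂]; ring
      rwa [this]
    have s3 : size (inver * (transl (-d) * M₁)) < n := by
      rw [small]
      -- The multiple of `-3 - d * d`, which vanishes, brings the entry to the form in
      -- `norm_hexagon`.
      have : (inver * (transl (-d) * M₁)) 1 0 =
          (2 * M 1 0 - d * M 0 0) + (-3 - d * d) * M 1 0 := by
        simp [hM₁]; ring
      rwa [this, hdd, sub_self, zero_mul, add_zero]
    have s4 : size (inver * (transl (-d) * M₂)) < n := by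
      rw [small]
      have : (inver * (transl (-d) * M₂)) 1 0 =
          (2 * M 0 0 + d * M 1 0) + (-3 - d * d) * M 0 0 := by
        simp [hM₂]; ring
      rwa [this, hdd, sub_self, zero_mul, add_zero]
    have hx : inver * (transl d * (inver * (transl (-d) * M₁))) =
      transl d * (inver * (transl (-d) * M₂)) := hexagon hdd M
    have s5 : size (inver * (transl d * (inver * (transl (-d) * M₁)))) < n :=
      (congrArg size hx).trans_lt ((size_transl d _).trans_lt s4)
    have hL : D.eval (inver * (transl d * (inver * (transl (-d) * M₁)))) =
        D.α * (D.tr d * (D.α * (D.tr (-d) * D.eval M₁))) := by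
      rw [ih.2 (transl d * (inver * (transl (-d) * M₁))) ((size_transl d _).trans_lt s3) s5,
        ih.1 _ _ s3, ih.2 (transl (-d) * M₁) ((size_transl (-d) M₁).trans_lt s1) s3, ih.1 _ _ s1]
    have hR : D.eval (transl d * (inver * (transl (-d) * M₂))) =
        D.tr d * (D.α * (D.tr (-d) * D.eval M₂)) := by
      rw [ih.1 _ _ s4, ih.2 (transl (-d) * M₂) ((size_transl (-d) M₂).trans_lt s2) s4, ih.1 _ _ s2]
    rw [hx, hR] at hL
    have hH := H (-d) (by rw [neg_neg]; exact s2)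
    rw [neg_neg] at hH
    rw [hH]
    have hb := D.braid_sqrtd hd'
    rw [neg_neg] at hb
    generalize D.eval M₁ = x₁ at *
    generalize D.eval M₂ = x₂ at *
    simp only [tr_neg] at hb hL ⊢
    -- Solving the matrix hexagon for `x₂` reduces the goal to the braid relation in `G`.
    have h3 : x₂ = D.tr d * (D.α * ((D.tr d)⁻¹ * (D.α * (D.tr d * (D.α * ((D.tr d)⁻¹ * x₁)))))) := by
      have := congrArg (fun x => D.tr d * (D.α * ((D.tr d)⁻¹ * x))) hL
      simpa [D.α_α_mul] using this
    have hb' := congrArg (· * (D.α * (D.tr d * (D.α * ((D.tr d)⁻¹ * x₁))))) hb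
    simp only [mul_assoc, D.α_α_mul, mul_inv_cancel_left, inv_mul_cancel_left] at hb'
    rw [h3, ← hb']

/-- Any reducing translation may replace the chosen `shift M`: `peak` is applied to `transl (-shift
M) * M`, with `d` the difference of the two translations. -/
theorem Compat.eval_shift {n : ℕ} (ih : D.Compat n) {M : SL(2, O32)} (hM : size M = n) {q : O32}
    (hq : (M 0 0 - q * M 1 0).norm < (M 1 0).norm) :
    D.eval M = D.tr q * (D.α * D.eval (inver * (transl (-q) * M))) := by
  have h : M 1 0 ≠ 0 := by
    intro h
    rw [h, Zsqrtd.norm_zero] at hq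
    exact absurd (norm_nonneg _) (not_le.2 hq)
  have hs := shift_spec h
  rw [D.eval_ne h]
  by_cases hqs : q = shift M
  · rw [hqs]
  set N := transl (-shift M) * M with hN
  have hN1 : N 1 0 = M 1 0 := by simp [hN]
  have hN0 : N 0 0 = M 0 0 - shift M * M 1 0 := by simp [hN, sub_eq_add_neg]
  have hMN : transl (-q) * M = transl (shift M - q) * N := by
    rw [hN, transl_transl]; congr 2; ring
  have hNn : size N = n := by rw [hN, size_transl, hM]
  have hSN : size (inver * N) < n := by
    rw [← hNn, size_lt, inver_mul_one, hN0, hN1]; exact hs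
  have := ih.peak (M := N) hNn (d := shift M - q) (sub_ne_zero.2 (Ne.symm hqs))
    (by rw [hN0, hN1]; exact hs.le)
    (by rw [hN0, hN1]; convert hq using 2; ring) (by
      intro q hq
      rw [ih.2 (transl (-q) * (inver * N)) ((size_transl (-q) _).trans_lt hSN) hq, ih.1 _ _ hSN, D.α_α_mul,
        ← mul_assoc (D.tr q), ← tr_add, add_neg_cancel, tr_zero, one_mul])
  rw [this, hMN, ← mul_assoc, ← tr_add]
  congr 2; ring

theorem compat (n : ℕ) : D.Compat n := by
  induction n with
  | zero => exact ⟨fun _ _ h => absurd h (by omega), fun _ h => absurd h (by omega)⟩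
  | succ n ih =>
    have hne : ∀ {M : SL(2, O32)} {N : SL(2, O32)}, size N < size M → M 1 0 ≠ 0 := by
      intro M N h h0
      simp [size, h0] at h
    refine ⟨fun z M hM => ?_, fun M hM hSM => ?_⟩
    · rcases Nat.lt_succ_iff_lt_or_eq.1 hM with hM | hM
      · exact ih.1 z M hM
      by_cases h : M 1 0 = 0
      · have hdet := det_eq M
        rw [h, mul_zero, sub_zero] at hdet
        rw [D.eval_zero h, D.eval_zero (by simpa using h), ← tr_add]
        congr 1
        simp only [transl_mul_zero, h]
        linear_combination z * hdet
      · have hs := shift_spec h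
        rw [ih.eval_shift hM hs, ih.eval_shift (M := transl z * M) (q := z + shift M)
          ((size_transl z M).trans hM) (by
            simp only [transl_mul_zero, transl_mul_one]
            convert hs using 2; ring), transl_transl, ← mul_assoc (D.tr z), ← tr_add]
        congr 6; ring
    · rcases Nat.lt_succ_iff_lt_or_eq.1 hM with hM | hM <;>
        rcases Nat.lt_succ_iff_lt_or_eq.1 hSM with hSM | hSM
      · exact ih.2 M hM hSM
      · have hlt : size (inver * (inver * M)) < size (inver * M) := by
          rw [inver_inver, size_neg]; omega
        rw [ih.eval_shift hSM (q := 0) (by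
          rw [size_lt] at hlt; simpa using hlt), tr_zero, one_mul, neg_zero, transl_zero, one_mul,
          inver_inver, eval_neg]
      · have hlt : size (inver * M) < size M := by omega
        rw [ih.eval_shift hM (q := 0) (by
          rw [size_lt] at hlt; simpa using hlt), tr_zero, one_mul, neg_zero, transl_zero, one_mul,
          D.α_α_mul]
      -- The tie: neither `M` nor `inver * M` is reduced by inversion alone, so `peak` is applied
      -- with `H` given by `eval_shift` for `inver * M`.
      · have hMS : (M 0 0).norm = (M 1 0).norm := by
          have h1 := size_cast M
          have h2 := size_cast (inver * M)
          rw [hM] at h1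
          rw [hSM, inver_mul_one] at h2
          rw [← h1, ← h2]
        have h : M 1 0 ≠ 0 := by
          intro h
          rw [h, Zsqrtd.norm_zero] at hMS
          have h0 : M 0 0 = 0 := by
            by_contra h0
            exact absurd (norm_pos h0) (by rw [hMS]; exact lt_irrefl _)
          have := det_eq M
          rw [h, h0] at this
          simp at this
        have hs := shift_spec h
        have h0 : shift M ≠ 0 := by
          intro h0
          rw [h0, zero_mul, sub_zero, hMS] at hs
          exact lt_irrefl _ hs
        have := ih.peak hM (d := -shift M) (neg_ne_zero.2 h0) hMS.le
          (by rwa [neg_mul, ← sub_eq_add_neg]) (by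
            intro q hq
            refine ih.eval_shift hSM ?_
            rw [← hSM, size_lt] at hq
            simpa [sub_eq_add_neg] using hq)
        rw [neg_neg, ← ih.eval_shift hM hs] at this
        rw [← this, D.α_α_mul]

theorem eq_of_mul_eq_one {p e : O32} (h : p * e = 1) :
    (p = 1 ∧ e = 1) ∨ (p = -1 ∧ e = -1) := by
  have hn : p.norm * e.norm = 1 := by rw [← Zsqrtd.norm_mul, h, Zsqrtd.norm_one]
  have hp : p.norm = 1 := Int.eq_one_of_mul_eq_one_right (norm_nonneg p) hn
  rw [norm_eq] at hp
  have h1 : p.im = 0 := by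
    have : p.im ^ 2 < 1 := by nlinarith [sq_nonneg p.re]
    nlinarith
  have h2 : p.re = 1 ∨ p.re = -1 := by
    rw [h1] at hp
    have : (p.re - 1) * (p.re + 1) = 0 := by linear_combination hp
    rcases mul_eq_zero.1 this with h | h <;> omega
  have h3 : p = 1 ∨ p = -1 := by
    rcases h2 with h2 | h2
    · exact Or.inl (Zsqrtd.ext h2 h1)
    · exact Or.inr (Zsqrtd.ext h2 h1)
  rcases h3 with rfl | rfl
  · exact Or.inl ⟨rfl, by simpa using h⟩
  · exact Or.inr ⟨rfl, by rw [← neg_inj]; simpa using h⟩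

/-! ### Multiplicativity and descent to `PSL₂`. -/

variable (D)

theorem eval_transl_mul (z : O32) (M : SL(2, O32)) :
    D.eval (transl z * M) = D.tr z * D.eval M :=
  (compat (size M + 1)).1 z M (Nat.lt_succ_self _)

theorem eval_inver_mul (M : SL(2, O32)) : D.eval (inver * M) = D.α * D.eval M :=
  (compat (size M + size (inver * M) + 1)).2 M (by omega) (by omega)

theorem eval_one : D.eval 1 = 1 := by
  rw [D.eval_zero (by simp)]
  simp [tr_zero]

theorem eval_transl (z : O32) : D.eval (transl z) = D.tr z := by
  rw [← mul_one (transl z), eval_transl_mul, eval_one, mul_one]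

theorem eval_inver : D.eval inver = D.α := by
  rw [← mul_one inver, eval_inver_mul, eval_one, mul_one]

theorem eval_mul (M N : SL(2, O32)) : D.eval (M * N) = D.eval M * D.eval N := by
  induction hn : size M using Nat.strong_induction_on generalizing M with
  | _ n ih =>
    by_cases h : M 1 0 = 0
    · have hdet := det_eq M
      rw [h, mul_zero, sub_zero] at hdet
      have key : M = transl (M 0 0 * M 0 1) ∨ M = -transl (M 0 0 * M 0 1) := by
        refine (eq_of_mul_eq_one hdet).imp ?_ ?_ <;> rintro ⟨h0, h1⟩ <;> apply sl_ext <;>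
          intro j <;> fin_cases j <;> simp [transl_coe, h, h0, h1]
      rcases key with h | h <;> rw [h]
      · rw [eval_transl_mul, eval_transl]
      · rw [neg_mul, eval_neg, eval_neg, eval_transl_mul, eval_transl]
    · set M' := inver * (transl (-shift M) * M) with hM'
      have hM : D.eval (M * N) = D.tr (shift M) * (D.α * D.eval (M' * N)) := by
        rw [hM', mul_assoc, mul_assoc, eval_inver_mul, eval_transl_mul, D.α_α_mul, ← mul_assoc,
          ← tr_add, add_neg_cancel, tr_zero, one_mul]
      rw [hM, D.eval_ne h, ← hM', ih _ (hn ▸ size_reduce M _ (shift_spec h)) M' rfl]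
      simp only [mul_assoc]

/-- The homomorphism from `SL₂(ℤ[√-3])`. -/
noncomputable def slHom : SL(2, O32) →* G := MonoidHom.mk' D.eval D.eval_mul

/-- The homomorphism from `PSL₂(ℤ[√-3])`. -/
noncomputable def hom : Gamma32 →* G :=
  QuotientGroup.lift _ D.slHom (by
    intro z hz
    rw [Matrix.SpecialLinearGroup.mem_center_iff] at hz
    obtain ⟨r, hr, hz⟩ := hz
    have hz' : z = 1 ∨ z = -1 := by
      rw [Fintype.card_fin, sq] at hr
      refine (eq_of_mul_eq_one hr).imp ?_ ?_ <;> rintro ⟨h0, -⟩ <;>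
        exact Subtype.ext (by rw [← hz, h0]; simp only [map_neg, map_one]; rfl)
    change D.eval z = 1
    rcases hz' with rfl | rfl
    · exact D.eval_one
    · rw [eval_neg, eval_one])

theorem hom_aElt : D.hom aElt = D.α := D.eval_inver

theorem hom_tElt : D.hom tElt = D.t := (D.eval_transl 1).trans D.tr_one

theorem hom_wElt : D.hom wElt = D.w := (D.eval_transl Zsqrtd.sqrtd).trans D.tr_sqrtd

end RelTriple

/-! ### Homomorphisms from `S₃`, `D(3,3,3)` and the amalgam -/

/-- The exponent of `sa` in the normal form `sa ^ i * sm ^ j`. -/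
def swapExp (p : S3) : ZMod 2 := if Equiv.Perm.sign p = 1 then 0 else 1

/-- The exponent of `sm` in the normal form `sa ^ i * sm ^ j`. -/
def rotExp (p : S3) : ZMod 3 := if Equiv.Perm.sign p = 1 then p 0 else sa (p 0)

theorem swapExp_mul : ∀ p q : S3, swapExp (p * q) = swapExp p + swapExp q := by decide

/-- Moving `sa` to the left past a power of `sm` inverts that power. -/
theorem rotExp_mul : ∀ p q : S3,
    rotExp (p * q) = (if swapExp q = 0 then rotExp p else -rotExp p) + rotExp q := by decide

theorem mul_zmodHom {G : Type*} [Group G] {a m : G} (hm : m ^ 3 = 1)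
    (ham : m * a = a * m⁻¹) (j : ZMod 3) :
    zmodHom 3 m hm (.ofAdd j) * a = a * zmodHom 3 m hm (.ofAdd (-j)) := by
  obtain ⟨k, rfl⟩ := ZMod.intCast_surjective j
  have h : ∀ k : ℤ, Multiplicative.ofAdd (k : ZMod 3) = Multiplicative.ofAdd (1 : ZMod 3) ^ k := by
    intro k
    rw [← ofAdd_zsmul, zsmul_one]
  rw [ofAdd_neg, h, map_inv, map_zpow, zmodHom_gen, ← inv_zpow]
  have hs : SemiconjBy a m⁻¹ m := ham.symm
  exact (hs.zpow_right k).eq.symm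

/-- The homomorphism from `S₃` with `sa ↦ a` and `sm ↦ m`. -/
def s3Hom {G : Type*} [Group G] (a m : G) (ha : a ^ 2 = 1) (hm : m ^ 3 = 1)
    (ham : m * a = a * m⁻¹) : S3 →* G :=
  MonoidHom.mk' (fun p => zmodHom 2 a ha (.ofAdd (swapExp p)) * zmodHom 3 m hm (.ofAdd (rotExp p)))
    (by
      intro p q
      rw [swapExp_mul, rotExp_mul, ofAdd_add, ofAdd_add, map_mul, map_mul]
      have h01 : ∀ i : ZMod 2, i = 0 ∨ i = 1 := by decide
      rcases h01 (swapExp q) with h | h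
      · simp [h, mul_assoc]
      · rw [h, if_neg (by decide), zmodHom_gen]
        simp only [mul_assoc]
        rw [← mul_assoc (zmodHom 3 m hm _) a, mul_zmodHom hm ham, mul_assoc])

theorem s3Hom_sa {G : Type*} [Group G] (a m : G) (ha : a ^ 2 = 1) (hm : m ^ 3 = 1)
    (ham : m * a = a * m⁻¹) : s3Hom a m ha hm ham sa = a := by
  have h1 : swapExp sa = 1 := by decide
  have h2 : rotExp sa = 0 := by decide
  change zmodHom 2 a ha (.ofAdd (swapExp sa)) * zmodHom 3 m hm (.ofAdd (rotExp sa)) = a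
  rw [h1, h2, zmodHom_gen, ofAdd_zero, map_one, mul_one]

theorem s3Hom_sm {G : Type*} [Group G] (a m : G) (ha : a ^ 2 = 1) (hm : m ^ 3 = 1)
    (ham : m * a = a * m⁻¹) : s3Hom a m ha hm ham sm = m := by
  have h1 : swapExp sm = 0 := by decide
  have h2 : rotExp sm = 1 := by decide
  change zmodHom 2 a ha (.ofAdd (swapExp sm)) * zmodHom 3 m hm (.ofAdd (rotExp sm)) = m
  rw [h1, h2, zmodHom_gen, ofAdd_zero, map_one, one_mul]

/-- The homomorphism from `D(3,3,3)` with `dx ↦ x` and `dy ↦ y`. -/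
def d333Hom {G : Type*} [Group G] (x y : G) (hx : x ^ 3 = 1) (hy : y ^ 3 = 1)
    (hxy : (x * y) ^ 3 = 1) : D333 →* G :=
  PresentedGroup.toGroup (rels := triangleRels) (f := ![x, y]) (by
    rintro r (rfl | rfl | rfl) <;> simpa)

theorem d333Hom_dx {G : Type*} [Group G] (x y : G) (hx : x ^ 3 = 1) (hy : y ^ 3 = 1)
    (hxy : (x * y) ^ 3 = 1) : d333Hom x y hx hy hxy dx = x := by
  simp [d333Hom, dx]

theorem d333Hom_dy {G : Type*} [Group G] (x y : G) (hx : x ^ 3 = 1) (hy : y ^ 3 = 1)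
    (hxy : (x * y) ^ 3 = 1) : d333Hom x y hx hy hxy dy = y := by
  simp [d333Hom, dy]

/-- The two homomorphisms on the factors as a family. -/
def factorHom {G : Type*} [Group G] (f : S3 →* G) (g : D333 →* G) : ∀ i, Factor i →* G
  | false => f
  | true => g

/-- The homomorphism from the amalgam that is given by compatible homomorphisms on the factors. -/
def amalgHom {G : Type*} [Group G] (f : S3 →* G) (g : D333 →* G) (h : f sm = g dy⁻¹) :
    Amalgam →* G :=
  Monoid.PushoutI.lift (factorHom f g) (f.comp c3ToS) (by
    have e1 : c3ToS (Multiplicative.ofAdd 1) = sm := zmodHom_gen 3 sm sm_pow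
    have e2 : c3ToD (Multiplicative.ofAdd 1) = dy⁻¹ := zmodHom_gen 3 dy⁻¹ dy_inv_pow
    intro i
    cases i
    · rfl
    · apply zmod_hom_ext
      change g (c3ToD (.ofAdd 1)) = f (c3ToS (.ofAdd 1))
      rw [e1, e2, h])

theorem amalgHom_inS {G : Type*} [Group G] (f : S3 →* G) (g : D333 →* G) (h : f sm = g dy⁻¹)
    (p : S3) : amalgHom f g h (inS p) = f p :=
  Monoid.PushoutI.lift_of (φ := amalgMap) (factorHom f g) _ _ (i := false) p

theorem amalgHom_inD {G : Type*} [Group G] (f : S3 →* G) (g : D333 →* G) (h : f sm = g dy⁻¹)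
    (d : D333) : amalgHom f g h (inD d) = g d :=
  Monoid.PushoutI.lift_of (φ := amalgMap) (factorHom f g) _ _ (i := true) d

/-! ### The homomorphism from the amalgam attached to a triple. -/

namespace RelTriple

variable {G : Type*} [Group G] (D : RelTriple G)

/-- The conjugate `w⁻¹ α w`. -/
def v : G := D.w⁻¹ * D.α * D.w

theorem v_mul : D.v * D.v = 1 := by simp [v, mul_assoc, D.α_α_mul]

theorem v_inv : D.v⁻¹ = D.v := inv_eq_of_mul_eq_one_left D.v_mul

theorem α_v_pow : (D.α * D.v) ^ 3 = 1 := D.rel_w_inv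

theorem v_t_pow : (D.v * D.t) ^ 3 = 1 := by
  have h : D.v * D.t = D.w⁻¹ * (D.α * D.t) * D.w⁻¹⁻¹ := by
    simp only [v, inv_inv, mul_assoc, D.comm.eq]
  rw [h, conj_pow, D.rel_t, mul_one, mul_inv_cancel]

/-- The homomorphism from the amalgam whose image is `⟨α, t, w⁻¹ α w⟩`. -/
def amalgamHom : Amalgam →* G :=
  amalgHom (s3Hom D.α (D.α * D.v) (by rw [sq, D.α_mul]) D.α_v_pow
      (by rw [mul_inv_rev, D.α_inv, D.v_inv, mul_assoc]))
    (d333Hom (D.α * D.t) (D.v * D.α) D.rel_t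
      (by rw [← inv_inj, ← inv_pow, mul_inv_rev, D.α_inv, D.v_inv, D.α_v_pow, inv_one])
      (by
        have h : D.α * D.t * (D.v * D.α) = (D.α * D.t) * (D.v * D.t) * (D.α * D.t)⁻¹ := by
          simp [mul_assoc, D.α_inv]
        rw [h, conj_pow, D.v_t_pow, mul_one, mul_inv_cancel]))
    (by rw [s3Hom_sm, map_inv, d333Hom_dy, mul_inv_rev, D.α_inv, D.v_inv])

theorem amalgamHom_sa : D.amalgamHom (inS sa) = D.α := by
  rw [amalgamHom, amalgHom_inS, s3Hom_sa]

theorem amalgamHom_sm : D.amalgamHom (inS sm) = D.α * D.v := by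
  rw [amalgamHom, amalgHom_inS, s3Hom_sm]

theorem amalgamHom_dx : D.amalgamHom (inD dx) = D.α * D.t := by
  rw [amalgamHom, amalgHom_inD, d333Hom_dx]

theorem amalgamHom_dy : D.amalgamHom (inD dy) = D.v * D.α := by
  rw [amalgamHom, amalgHom_inD, d333Hom_dy]

end RelTriple

/-! ### The homomorphism `τ` -/

theorem gamma_eq_one {M : SL(2, O32)} (h : M = -1) : (QuotientGroup.mk M : Gamma32) = 1 := by
  rw [QuotientGroup.eq_one_iff, h]
  exact Subgroup.mem_center_iff.2 fun g => by rw [mul_neg, neg_mul, mul_one, one_mul]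

theorem transl_mul_transl (y z : O32) : transl y * transl z = transl (y + z) := by
  have := transl_transl y z 1
  rwa [mul_one, mul_one] at this

theorem transl_inv (z : O32) : (transl z)⁻¹ = transl (-z) := by
  rw [inv_eq_iff_mul_eq_one, transl_mul_transl, add_neg_cancel, transl_zero]

/-- The elements `a`, `t`, `w` of `Γ_{3,2}`. -/
def gammaTriple : RelTriple Gamma32 where
  α := aElt
  t := tElt
  w := wElt
  α_mul := by
    change (QuotientGroup.mk (inver * inver) : Gamma32) = 1
    apply gamma_eq_one
    have := inver_inver 1
    rwa [mul_one] at this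
  comm := by
    change (QuotientGroup.mk (transl 1 * transl Zsqrtd.sqrtd) : Gamma32) =
      QuotientGroup.mk (transl Zsqrtd.sqrtd * transl 1)
    rw [transl_mul_transl, transl_mul_transl, add_comm]
  rel_t := by
    change (QuotientGroup.mk ((inver * transl 1) ^ 3) : Gamma32) = 1
    apply gamma_eq_one
    decide
  rel_w := by
    change (QuotientGroup.mk
      ((inver * (transl Zsqrtd.sqrtd * inver * (transl Zsqrtd.sqrtd)⁻¹)) ^ 3) : Gamma32) = 1
    apply gamma_eq_one
    rw [transl_inv]
    decide

theorem psi_inS (p : S3) : psi (inS p) = inS (psiS p) := psiHom_inS p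

theorem psi_inD (d : D333) : psi (inD d) = inD (psiD d) := psiHom_inD d

/-- The generator of `ℤ/2` in `P`. -/
def pGen : P := SemidirectProduct.inr (Multiplicative.ofAdd 1)

theorem pGen_conj (z : Amalgam) :
    pGen * SemidirectProduct.inl z * pGen⁻¹ = SemidirectProduct.inl (psi z) := by
  rw [pGen, ← map_inv, ← SemidirectProduct.inl_aut, zmodHom_gen]

theorem pGen_inv : pGen⁻¹ = pGen := by
  rw [pGen, ← map_inv]
  rfl

/-- The elements `α`, `α x` and the generator of `ℤ/2` of `P`. -/
def pTriple : RelTriple P where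
  α := SemidirectProduct.inl (inS sa)
  t := SemidirectProduct.inl (inS sa * inD dx)
  w := pGen
  α_mul := by
    have h : sa * sa = 1 := by decide
    rw [← map_mul, ← map_mul, h, map_one, map_one]
  comm := by
    rw [commute_iff_eq, eq_comm, ← mul_inv_eq_iff_eq_mul, pGen_conj]
    congr 1
    -- `ψ` fixes `αx`, since `ψ(αx) = αm·yx` and `m = y⁻¹`.
    rw [map_mul, psi_inS, psi_inD, psiS_sa, psiD_dx, map_mul, map_mul, inS_sm, map_inv]
    simp [mul_assoc]
  rel_t := by
    have h : sa * sa = 1 := by decide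
    rw [← map_mul, ← mul_assoc, ← map_mul, h, map_one, one_mul, ← map_pow, ← map_pow, dx_pow,
      map_one, map_one]
  rel_w := by
    have h : (sa * (sa * sm)) ^ 3 = 1 := by decide
    rw [pGen_conj, psi_inS, psiS_sa, ← map_mul, ← map_mul, ← map_pow, ← map_pow, h, map_one,
      map_one]

/-- The homomorphism `τ : Γ_{3,2} → P`. -/
noncomputable def tau : Gamma32 →* P := pTriple.hom

theorem tau_aElt : tau aElt = SemidirectProduct.inl (inS sa) := pTriple.hom_aElt

theorem tau_tElt : tau tElt = SemidirectProduct.inl (inS sa * inD dx) := pTriple.hom_tElt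

theorem tau_wElt : tau wElt = pGen := pTriple.hom_wElt

/-- Both surjectivity and injectivity on `K32` rest on this identity. -/
theorem tau_comp_amalgamHom : tau.comp gammaTriple.amalgamHom = SemidirectProduct.inl := by
  have h : sa * sa = 1 := by decide
  apply amalgam_hom_ext
  · rw [MonoidHom.comp_apply, RelTriple.amalgamHom_sa]
    exact tau_aElt
  · rw [MonoidHom.comp_apply, RelTriple.amalgamHom_dx]
    change tau (aElt * tElt) = _
    rw [map_mul, tau_aElt, tau_tElt, ← map_mul, ← mul_assoc, ← map_mul, h, map_one, one_mul]
  · rw [MonoidHom.comp_apply, RelTriple.amalgamHom_dy]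
    change tau (wElt⁻¹ * aElt * wElt * aElt) = _
    have h' : sa * sm * sa = sm⁻¹ := by decide
    have hp := pGen_conj (inS sa)
    rw [pGen_inv] at hp
    rw [map_mul, map_mul, map_mul, map_inv, tau_aElt, tau_wElt, pGen_inv, hp, psi_inS, psiS_sa,
      ← map_mul, ← map_mul, h', map_inv, inS_sm, map_inv,
      map_inv, map_inv, inv_inv]

theorem tau_surjective : Function.Surjective tau := by
  intro p
  obtain ⟨k, hk⟩ := ZMod.intCast_surjective p.right.toAdd
  have hr : p.right = Multiplicative.ofAdd (1 : ZMod 2) ^ k := by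
    rw [← ofAdd_zsmul, zsmul_one, hk, ofAdd_toAdd]
  refine ⟨gammaTriple.amalgamHom p.left * wElt ^ k, ?_⟩
  rw [map_mul, ← MonoidHom.comp_apply, tau_comp_amalgamHom, map_zpow, tau_wElt, pGen, ← map_zpow,
    ← hr, SemidirectProduct.inl_left_mul_inr_right]

theorem K32_le : K32 ≤ gammaTriple.amalgamHom.range := by
  rw [K32, Subgroup.closure_le]
  have ha : gammaTriple.amalgamHom (inS sa) = aElt := gammaTriple.amalgamHom_sa
  rintro g (rfl | rfl | rfl)
  · exact ⟨_, ha⟩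
  · refine ⟨inS sa * inD dx, ?_⟩
    rw [map_mul, gammaTriple.amalgamHom_sa, gammaTriple.amalgamHom_dx, gammaTriple.α_α_mul]
    rfl
  · refine ⟨inS sa * inS sm, ?_⟩
    rw [map_mul, gammaTriple.amalgamHom_sa, gammaTriple.amalgamHom_sm, gammaTriple.α_α_mul]
    rfl

theorem tau_injOn : Set.InjOn tau (K32 : Set Gamma32) := by
  intro g hg g' hg' h
  obtain ⟨z, rfl⟩ := K32_le hg
  obtain ⟨z', rfl⟩ := K32_le hg'
  rw [← MonoidHom.comp_apply, ← MonoidHom.comp_apply, tau_comp_amalgamHom] at h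
  rw [SemidirectProduct.inl_injective h]

/-! ### The amalgam as a semidirect product of a free product of lattices and `S₃` -/

/-- The root lattice of type `A₂`. -/
def rootLattice : AddSubgroup (Fin 3 → ℤ) where
  carrier := {v | ∑ i, v i = 0}
  zero_mem' := by simp
  add_mem' := by
    intro v w hv hw
    simp only [Set.mem_ofPred_eq] at *
    simp [Finset.sum_add_distrib, hv, hw]
  neg_mem' := by
    intro v hv
    simp only [Set.mem_ofPred_eq] at *
    simp [hv]

/-- The root lattice of type `A₂`, written multiplicatively. -/
abbrev Lat : Type := Multiplicative rootLattice

/-- The coordinates of an element of the lattice. -/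
def coord (v : Lat) : Fin 3 → ℤ := (v.toAdd : Fin 3 → ℤ)

theorem coord_sum (v : Lat) : coord v 0 + coord v 1 + coord v 2 = 0 := by
  have h : ∑ i, coord v i = 0 := v.toAdd.2
  rwa [Fin.sum_univ_three] at h

theorem lat_ext {v w : Lat} (h : ∀ i, coord v i = coord w i) : v = w :=
  Multiplicative.toAdd.injective (Subtype.ext (funext h))

theorem coord_mul (v w : Lat) (i : Fin 3) : coord (v * w) i = coord v i + coord w i := rfl

theorem coord_one (i : Fin 3) : coord 1 i = 0 := rfl

theorem coord_zpow (v : Lat) (k : ℤ) (i : Fin 3) : coord (v ^ k) i = k * coord v i := by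
  change ((k • v.toAdd : rootLattice) : Fin 3 → ℤ) i = _
  simp [coord]

/-- The action of `S₃` on the lattice by permutation of the coordinates. -/
def act (σ : S3) : Lat →* Lat :=
  AddMonoidHom.toMultiplicative
    { toFun := fun v => ⟨fun i => (v : Fin 3 → ℤ) (σ⁻¹ i),
        (Equiv.sum_comp σ⁻¹ (v : Fin 3 → ℤ)).trans v.2⟩
      map_zero' := rfl
      map_add' := fun _ _ => rfl }

theorem coord_act (σ : S3) (v : Lat) (i : Fin 3) : coord (act σ v) i = coord v (σ⁻¹ i) := rfl

theorem act_one (v : Lat) : act 1 v = v := rfl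

theorem act_mul (σ τ : S3) (v : Lat) : act (σ * τ) v = act σ (act τ v) := by
  apply lat_ext
  intro i
  rw [coord_act, coord_act, coord_act, mul_inv_rev, Equiv.Perm.mul_apply]

/-- The free product of two copies of the lattice, indexed by the signs. -/
abbrev FreeLat : Type := Monoid.CoprodI fun _ : ℤˣ => Lat

/-- The inclusion of a factor of the free product. -/
def inLat (i : ℤˣ) : Lat →* FreeLat := Monoid.CoprodI.of (M := fun _ : ℤˣ => Lat) (i := i)

theorem freeLat_hom_ext {G : Type*} [Group G] {f g : FreeLat →* G}
    (h : ∀ i v, f (inLat i v) = g (inLat i v)) : f = g :=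
  Monoid.CoprodI.ext_hom f g fun i => MonoidHom.ext fun v => h i v

/-- The homomorphism from the free product that is given by homomorphisms on the factors. -/
def freeLatHom {G : Type*} [Group G] (f : ℤˣ → Lat →* G) : FreeLat →* G :=
  Monoid.CoprodI.lift (M := fun _ : ℤˣ => Lat) f

theorem freeLatHom_inLat {G : Type*} [Group G] (f : ℤˣ → Lat →* G) (i : ℤˣ) (v : Lat) :
    freeLatHom f (inLat i v) = f i v :=
  Monoid.CoprodI.lift_of (M := fun _ : ℤˣ => Lat) f v

/-- The action of `S₃` on the free product. -/
def shuffle (σ : S3) : FreeLat →* FreeLat :=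
  freeLatHom fun i => (inLat (Equiv.Perm.sign σ * i)).comp (act σ)

theorem shuffle_inLat (σ : S3) (i : ℤˣ) (v : Lat) :
    shuffle σ (inLat i v) = inLat (Equiv.Perm.sign σ * i) (act σ v) :=
  freeLatHom_inLat _ i v

theorem shuffle_mul (σ τ : S3) : shuffle (σ * τ) = (shuffle σ).comp (shuffle τ) := by
  apply freeLat_hom_ext
  intro i v
  rw [MonoidHom.comp_apply, shuffle_inLat, shuffle_inLat, shuffle_inLat, act_mul,
    Equiv.Perm.sign_mul, mul_assoc]

theorem shuffle_one : shuffle 1 = MonoidHom.id _ := by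
  apply freeLat_hom_ext
  intro i v
  rw [shuffle_inLat, act_one, Equiv.Perm.sign_one, one_mul, MonoidHom.id_apply]

/-- The action of `S₃` on the free product by automorphisms. -/
def shuffleAut : S3 →* MulAut FreeLat where
  toFun σ := MonoidHom.toMulEquiv (shuffle σ) (shuffle σ⁻¹)
    (by rw [← shuffle_mul, inv_mul_cancel, shuffle_one])
    (by rw [← shuffle_mul, mul_inv_cancel, shuffle_one])
  map_one' := by
    ext z
    exact DFunLike.congr_fun shuffle_one z
  map_mul' σ τ := by
    ext z
    exact DFunLike.congr_fun (shuffle_mul σ τ) z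

theorem shuffleAut_apply (σ : S3) (z : FreeLat) : shuffleAut σ z = shuffle σ z := rfl

/-- The semidirect product that is isomorphic to the amalgam. -/
abbrev LatSemi : Type := FreeLat ⋊[shuffleAut] S3

/-- The translations in the first factor. -/
def trans : Lat →* LatSemi := SemidirectProduct.inl.comp (inLat 1)

theorem inr_mul_trans {σ : S3} (hσ : Equiv.Perm.sign σ = 1) (v : Lat) :
    (SemidirectProduct.inr σ : LatSemi) * trans v = trans (act σ v) * SemidirectProduct.inr σ := by
  rw [← mul_inv_eq_iff_eq_mul, ← map_inv, trans, MonoidHom.comp_apply,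
    ← SemidirectProduct.inl_aut, shuffleAut_apply, shuffle_inLat, hσ, mul_one]
  rfl

theorem trans_mul_inr_pow {σ : S3} (hσ : Equiv.Perm.sign σ = 1) (h3 : σ ^ 3 = 1)
    (hv : ∀ v, v * (act σ v * act σ (act σ v)) = 1) (v : Lat) :
    (trans v * SemidirectProduct.inr σ) ^ 3 = 1 := by
  have h : (trans v * SemidirectProduct.inr σ) ^ 3 =
      trans (v * (act σ v * act σ (act σ v))) * SemidirectProduct.inr (σ ^ 3) := by
    simp only [pow_succ, pow_zero, one_mul, map_mul, mul_assoc]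
    simp only [← mul_assoc (SemidirectProduct.inr σ) (trans _), inr_mul_trans hσ, mul_assoc]
  rw [h, hv, h3, map_one, map_one, one_mul]

/-- The sum of an orbit of a 3-cycle is constant with value the coordinate sum, which is zero. -/
theorem rot_sum {σ : S3} (hσ : σ = sm⁻¹ ∨ σ = sm) (v : Lat) :
    v * (act σ v * act σ (act σ v)) = 1 := by
  have e0 : sm 0 = 1 := by decide
  have e1 : sm 1 = 2 := by decide
  have e2 : sm 2 = 0 := by decide
  have f0 : sm⁻¹ 0 = 2 := by decide
  have f1 : sm⁻¹ 1 = 0 := by decide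
  have f2 : sm⁻¹ 2 = 1 := by decide
  have := coord_sum v
  apply lat_ext
  intro i
  rcases hσ with rfl | rfl <;> fin_cases i <;>
    simp [coord_mul, coord_act, coord_one, e0, e1, e2, f0, f1, f2] <;> omega

/-- The root `e₀ - e₁`. -/
def root₀ : Lat := .ofAdd ⟨![1, -1, 0], by simp [rootLattice, Fin.sum_univ_three]⟩

/-- The root `e₁ - e₂`. -/
def root₁ : Lat := .ofAdd ⟨![0, 1, -1], by simp [rootLattice, Fin.sum_univ_three]⟩

theorem root_decomp (v : Lat) : root₀ ^ coord v 0 * root₁ ^ (-coord v 2) = v := by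
  have := coord_sum v
  apply lat_ext
  intro i
  rw [coord_mul, coord_zpow, coord_zpow]
  fin_cases i <;> simp [root₀, root₁, coord] at *
  omega

theorem act_sm_root₀ : act sm root₀ = root₁ := by
  apply lat_ext
  decide

/-- The homomorphism from `D(3,3,3)` to the semidirect product. -/
def d333ToSemi : D333 →* LatSemi :=
  d333Hom (trans root₀ * SemidirectProduct.inr sm⁻¹) (SemidirectProduct.inr sm⁻¹)
    (trans_mul_inr_pow (by decide) (by decide) (rot_sum (Or.inl rfl)) _)
    (by rw [← map_pow, inv_pow, sm_pow, inv_one, map_one])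
    (by
      have h : sm⁻¹ * sm⁻¹ = sm := by decide
      rw [mul_assoc, ← map_mul, h]
      exact trans_mul_inr_pow (by decide) sm_pow (rot_sum (Or.inr rfl)) _)

theorem d333ToSemi_dx : d333ToSemi dx = trans root₀ * SemidirectProduct.inr sm⁻¹ :=
  d333Hom_dx _ _ _ _ _

theorem d333ToSemi_dy : d333ToSemi dy = SemidirectProduct.inr sm⁻¹ :=
  d333Hom_dy _ _ _ _ _

/-- The homomorphism from the amalgam to the semidirect product. -/
def toSemi : Amalgam →* LatSemi :=
  amalgHom SemidirectProduct.inr d333ToSemi (by rw [map_inv, d333ToSemi_dy, map_inv, inv_inv])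

theorem toSemi_inS (σ : S3) : toSemi (inS σ) = SemidirectProduct.inr σ := amalgHom_inS _ _ _ σ

theorem toSemi_inD (d : D333) : toSemi (inD d) = d333ToSemi d := amalgHom_inD _ _ _ d

/-! ### The translation lattice inside `D(3,3,3)`. -/

theorem dxyx : dx * dy * dx = dy⁻¹ * dx⁻¹ * dy⁻¹ := by
  have h := dxy_pow
  rw [← mul_inv_eq_one]
  simpa [pow_succ, mul_assoc] using h

theorem dy_inv_mul_dy_inv : dy⁻¹ * dy⁻¹ = dy := by
  rw [← mul_inv_eq_one]
  have h := dy_inv_pow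
  rwa [pow_succ, sq] at h

theorem dx_inv_mul_dx_inv : dx⁻¹ * dx⁻¹ = dx := by
  rw [← mul_inv_eq_one]
  have h : dx⁻¹ ^ 3 = 1 := by rw [inv_pow, dx_pow, inv_one]
  rwa [pow_succ, sq] at h

theorem dx_mul_dx : dx * dx = dx⁻¹ := by
  rw [← inv_inj, mul_inv_rev, dx_inv_mul_dx_inv, inv_inv]

theorem translations_mul : dx * dy⁻¹ * (dy⁻¹ * dx) = dy⁻¹ * dx⁻¹ * dy⁻¹ := by
  calc dx * dy⁻¹ * (dy⁻¹ * dx) = dx * (dy⁻¹ * dy⁻¹) * dx := by group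
    _ = dy⁻¹ * dx⁻¹ * dy⁻¹ := by rw [dy_inv_mul_dy_inv, dxyx]

/-- These elements correspond to `root₀` and `root₁`; both products equal `y⁻¹x⁻¹y⁻¹`. -/
theorem commute_translations : Commute (dx * dy⁻¹) (dy⁻¹ * dx) := by
  rw [commute_iff_eq, translations_mul, ← dx_mul_dx]
  group

/-- The inclusion of the lattice in `D(3,3,3)`. -/
def latToD : Lat →* D333 where
  toFun v := (dx * dy⁻¹) ^ coord v 0 * (dy⁻¹ * dx) ^ (-coord v 2)
  map_one' := by simp [coord_one]
  map_mul' v w := by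
    rw [coord_mul, coord_mul, zpow_add, neg_add, zpow_add, mul_assoc, mul_assoc,
      ← mul_assoc ((dx * dy⁻¹) ^ coord w 0), (commute_translations.zpow_zpow _ _).eq, mul_assoc]

theorem latToD_apply (v : Lat) :
    latToD v = (dx * dy⁻¹) ^ coord v 0 * (dy⁻¹ * dx) ^ (-coord v 2) := rfl

/-- Conjugation by `y⁻¹` sends `root₀` to `root₁` and `root₁` to the inverse of their product, as
the rotation `sm` does. -/
theorem dy_inv_conj_latToD (v : Lat) : dy⁻¹ * latToD v * dy = latToD (act sm v) := by
  have f0 : sm⁻¹ 0 = 2 := by decide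
  have f2 : sm⁻¹ 2 = 1 := by decide
  have h := coord_sum v
  have h1 : dy⁻¹ * (dx * dy⁻¹) * dy⁻¹⁻¹ = dy⁻¹ * dx := by group
  have h2 : dy⁻¹ * (dy⁻¹ * dx) * dy⁻¹⁻¹ = (dx * dy⁻¹ * (dy⁻¹ * dx))⁻¹ := by
    rw [translations_mul]
    calc dy⁻¹ * (dy⁻¹ * dx) * dy⁻¹⁻¹ = dy⁻¹ * dy⁻¹ * dx * dy := by group
      _ = _ := by rw [dy_inv_mul_dy_inv]; group
  rw [latToD_apply, latToD_apply, coord_act, coord_act, f0, f2]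
  have h3 : dy⁻¹ * ((dx * dy⁻¹) ^ coord v 0 * (dy⁻¹ * dx) ^ (-coord v 2)) * dy =
      (dy⁻¹ * (dx * dy⁻¹) * dy⁻¹⁻¹) ^ coord v 0 *
        (dy⁻¹ * (dy⁻¹ * dx) * dy⁻¹⁻¹) ^ (-coord v 2) := by
    rw [conj_zpow, conj_zpow]; group
  rw [h3, h1, h2, inv_zpow', neg_neg, commute_translations.mul_zpow,
    ((commute_translations.symm).zpow_zpow (coord v 0) (coord v 2)).left_comm, ← zpow_add]
  congr 2
  omega

theorem latToD_root₀ : latToD root₀ = dx * dy⁻¹ := by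
  simp [latToD_apply, root₀, coord]

theorem d333ToSemi_latToD (v : Lat) : d333ToSemi (latToD v) = trans v := by
  have h0 : d333ToSemi (dx * dy⁻¹) = trans root₀ := by
    rw [map_mul, map_inv, d333ToSemi_dx, d333ToSemi_dy, mul_inv_cancel_right]
  have h1 : d333ToSemi (dy⁻¹ * dx) = trans root₁ := by
    rw [map_mul, map_inv, d333ToSemi_dx, d333ToSemi_dy, map_inv, inv_inv, ← mul_assoc,
      inr_mul_trans (by decide), act_sm_root₀, mul_inv_cancel_right]
  rw [latToD_apply, map_mul, map_zpow, map_zpow, h0, h1, ← map_zpow, ← map_zpow, ← map_mul,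
    root_decomp]

/-! ### The map from the semidirect product back to the amalgam. -/

theorem inS_sa_mul : inS sa * inS sa = 1 := by
  have h : sa * sa = 1 := by decide
  rw [← map_mul, h, map_one]

theorem inS_sa_inv : (inS sa)⁻¹ = inS sa := inv_eq_of_mul_eq_one_left inS_sa_mul

/-- The two embeddings of the lattice in the amalgam. -/
def latToAmalgam (i : ℤˣ) : Lat →* Amalgam :=
  if i = 1 then inD.comp latToD
  -- The twist by `act sa` makes the two embeddings together equivariant for `shuffle sa`.
  else (MulAut.conj (inS sa)).toMonoidHom.comp ((inD.comp latToD).comp (act sa))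

theorem latToAmalgam_one (v : Lat) : latToAmalgam 1 v = inD (latToD v) := rfl

theorem latToAmalgam_neg_one (v : Lat) :
    latToAmalgam (-1) v = inS sa * inD (latToD (act sa v)) * (inS sa)⁻¹ := rfl

/-- The homomorphism from the free product to the amalgam. -/
def freeLatToAmalgam : FreeLat →* Amalgam := freeLatHom latToAmalgam

theorem freeLatToAmalgam_inLat (i : ℤˣ) (v : Lat) :
    freeLatToAmalgam (inLat i v) = latToAmalgam i v := freeLatHom_inLat _ i v

theorem freeLatToAmalgam_shuffle_sa (z : FreeLat) :
    freeLatToAmalgam (shuffle sa z) = inS sa * freeLatToAmalgam z * (inS sa)⁻¹ := by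
  have hs : Equiv.Perm.sign sa = -1 := by decide
  have hsa : ∀ v, act sa (act sa v) = v := fun v => by
    rw [← act_mul, show sa * sa = 1 by decide, act_one]
  refine DFunLike.congr_fun (f := freeLatToAmalgam.comp (shuffle sa))
    (g := (MulAut.conj (inS sa)).toMonoidHom.comp freeLatToAmalgam) (freeLat_hom_ext ?_) z
  intro i v
  change freeLatToAmalgam (shuffle sa (inLat i v)) =
    inS sa * freeLatToAmalgam (inLat i v) * (inS sa)⁻¹
  rw [shuffle_inLat, freeLatToAmalgam_inLat, freeLatToAmalgam_inLat, hs]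
  rcases Int.units_eq_one_or i with rfl | rfl
  · rw [mul_one, latToAmalgam_one, latToAmalgam_neg_one, hsa]
  · rw [neg_mul_neg, mul_one, latToAmalgam_one, latToAmalgam_neg_one, inS_sa_inv]
    simp only [mul_assoc, inS_sa_mul, mul_one]
    rw [← mul_assoc, inS_sa_mul, one_mul]

theorem inS_sm_conj_inD (v : Lat) :
    inS sm * inD (latToD v) * (inS sm)⁻¹ = inD (latToD (act sm v)) := by
  rw [inS_sm, map_inv, inv_inv, ← map_inv, ← map_mul, ← map_mul, dy_inv_conj_latToD]

theorem freeLatToAmalgam_shuffle_sm (z : FreeLat) :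
    freeLatToAmalgam (shuffle sm z) = inS sm * freeLatToAmalgam z * (inS sm)⁻¹ := by
  have hs : Equiv.Perm.sign sm = 1 := by decide
  refine DFunLike.congr_fun (f := freeLatToAmalgam.comp (shuffle sm))
    (g := (MulAut.conj (inS sm)).toMonoidHom.comp freeLatToAmalgam) (freeLat_hom_ext ?_) z
  intro i v
  change freeLatToAmalgam (shuffle sm (inLat i v)) =
    inS sm * freeLatToAmalgam (inLat i v) * (inS sm)⁻¹
  rw [shuffle_inLat, freeLatToAmalgam_inLat, freeLatToAmalgam_inLat, hs, one_mul]
  rcases Int.units_eq_one_or i with rfl | rfl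
  · rw [latToAmalgam_one, latToAmalgam_one, inS_sm_conj_inD]
  · have e1 : sa * sm = sm⁻¹ * sa := by decide
    have e2 : sa = sm * sa * sm := by decide
    have h : act sa v = act sm (act sa (act sm v)) := by rw [← act_mul, ← act_mul, ← e2]
    rw [latToAmalgam_neg_one, latToAmalgam_neg_one, h, ← inS_sm_conj_inD]
    have e3 : inS sm * inS sa * inS sm = inS sa := by rw [← map_mul, ← map_mul, ← e2]
    generalize inD (latToD (act sa (act sm v))) = d
    calc inS sa * d * (inS sa)⁻¹
        = (inS sm * inS sa * inS sm) * d * (inS sm * inS sa * inS sm)⁻¹ := by rw [e3]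
      _ = _ := by group

theorem freeLatToAmalgam_shuffle (σ : S3) (z : FreeLat) :
    freeLatToAmalgam (shuffle σ z) = inS σ * freeLatToAmalgam z * (inS σ)⁻¹ := by
  have hmul : ∀ σ τ : S3,
      (∀ z, freeLatToAmalgam (shuffle σ z) = inS σ * freeLatToAmalgam z * (inS σ)⁻¹) →
      (∀ z, freeLatToAmalgam (shuffle τ z) = inS τ * freeLatToAmalgam z * (inS τ)⁻¹) →
      ∀ z, freeLatToAmalgam (shuffle (σ * τ) z) =
        inS (σ * τ) * freeLatToAmalgam z * (inS (σ * τ))⁻¹ := by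
    intro σ τ hσ hτ z
    rw [shuffle_mul, MonoidHom.comp_apply, hσ, hτ, map_mul]
    group
  have key : ∀ σ : S3, σ = sm * sm * sm ∨ σ = sm ∨ σ = sm * sm ∨ σ = sa ∨ σ = sa * sm ∨
      σ = sa * (sm * sm) := by decide
  have ha := freeLatToAmalgam_shuffle_sa
  have hm := freeLatToAmalgam_shuffle_sm
  have hmm := hmul _ _ hm hm
  rcases key σ with rfl | rfl | rfl | rfl | rfl | rfl
  · exact hmul _ _ hmm hm z
  · exact hm z
  · exact hmm z
  · exact ha z
  · exact hmul _ _ ha hm z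
  · exact hmul _ _ ha hmm z

/-- The homomorphism from the semidirect product to the amalgam. -/
def ofSemi : LatSemi →* Amalgam :=
  SemidirectProduct.lift freeLatToAmalgam inS (by
    intro σ
    exact MonoidHom.ext fun z => freeLatToAmalgam_shuffle σ z)

theorem ofSemi_comp_toSemi : ofSemi.comp toSemi = MonoidHom.id Amalgam := by
  have hy : ofSemi (SemidirectProduct.inr sm⁻¹) = inD dy := by
    rw [ofSemi, SemidirectProduct.lift_inr, map_inv, inS_sm, map_inv, inv_inv]
  have hx : ofSemi (trans root₀) = inD (dx * dy⁻¹) := by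
    rw [ofSemi, trans, MonoidHom.comp_apply, SemidirectProduct.lift_inl, freeLatToAmalgam_inLat,
      latToAmalgam_one, latToD_root₀]
  apply amalgam_hom_ext
  · rw [MonoidHom.comp_apply, toSemi_inS, ofSemi, SemidirectProduct.lift_inr, MonoidHom.id_apply]
  · rw [MonoidHom.comp_apply, toSemi_inD, d333ToSemi_dx, map_mul, hx, hy, ← map_mul,
      inv_mul_cancel_right, MonoidHom.id_apply]
  · rw [MonoidHom.comp_apply, toSemi_inD, d333ToSemi_dy, hy, MonoidHom.id_apply]

theorem toSemi_comp_freeLatToAmalgam : toSemi.comp freeLatToAmalgam = SemidirectProduct.inl := by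
  have hs : Equiv.Perm.sign sa = -1 := by decide
  apply freeLat_hom_ext
  intro i v
  rw [MonoidHom.comp_apply, freeLatToAmalgam_inLat]
  rcases Int.units_eq_one_or i with rfl | rfl
  · rw [latToAmalgam_one, toSemi_inD, d333ToSemi_latToD]
    rfl
  · rw [latToAmalgam_neg_one, map_mul, map_mul, map_inv, toSemi_inD, d333ToSemi_latToD,
      toSemi_inS, ← map_inv, trans, MonoidHom.comp_apply, ← SemidirectProduct.inl_aut,
      shuffleAut_apply, shuffle_inLat, hs, mul_one, ← act_mul, show sa * sa = 1 by decide, act_one]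

theorem freeLatToAmalgam_injective : Function.Injective freeLatToAmalgam := by
  intro z z' h
  have h' := congrArg toSemi h
  rw [← MonoidHom.comp_apply, ← MonoidHom.comp_apply, toSemi_comp_freeLatToAmalgam] at h'
  exact SemidirectProduct.inl_injective h'

/-- Only the left inverse `ofSemi` of `toSemi` is needed to lift a kernel element to the free
product. -/
theorem range_freeLatToAmalgam :
    freeLatToAmalgam.range = (SemidirectProduct.rightHom.comp toSemi).ker := by
  ext g
  rw [MonoidHom.mem_ker]
  constructor
  · rintro ⟨z, rfl⟩
    rw [MonoidHom.comp_apply, ← MonoidHom.comp_apply toSemi, toSemi_comp_freeLatToAmalgam,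
      SemidirectProduct.rightHom_inl]
  · intro h
    have hg : toSemi g = SemidirectProduct.inl (toSemi g).left := by
      conv_lhs => rw [← SemidirectProduct.inl_left_mul_inr_right (toSemi g)]
      have h' : (toSemi g).right = 1 := h
      rw [h', map_one, mul_one]
    refine ⟨(toSemi g).left, ?_⟩
    have := congrArg ofSemi hg
    rw [← MonoidHom.comp_apply, ofSemi_comp_toSemi, ofSemi, SemidirectProduct.lift_inl] at this
    exact this.symm

theorem isVirtuallyFreeProduct_P : IsVirtuallyFreeProduct P := by
  have hinj : Function.Injective
      ((SemidirectProduct.inl : Amalgam →* P).comp freeLatToAmalgam) :=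
    SemidirectProduct.inl_injective.comp freeLatToAmalgam_injective
  refine ⟨((SemidirectProduct.inl : Amalgam →* P).comp freeLatToAmalgam).range, ⟨?_⟩,
    ℤˣ, fun _ => Lat, fun _ => inferInstance, PEmpty, fun _ => inferInstance, ⟨?_⟩⟩
  · rw [MonoidHom.range_comp, Subgroup.index_map_of_injective _ SemidirectProduct.inl_injective,
      range_freeLatToAmalgam, SemidirectProduct.range_inl_eq_ker_rightHom, Subgroup.index_ker,
      Subgroup.index_ker]
    -- The index is the product of the orders of the images in `S₃` and in `ℤ/2`.
    exact mul_ne_zero Nat.card_pos.ne' Nat.card_pos.ne'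
  · exact (MonoidHom.ofInjective hinj).symm.trans
      ((MulEquiv.coprodPUnit.{0, 0} FreeLat).symm.trans
        (MulEquiv.coprodCongr (MulEquiv.refl _) MulEquiv.ofUnique))

end Bianchi

theorem lemma3p1 :
    (∃ τ : Bianchi.Gamma32 →* Bianchi.P,
      Function.Surjective τ ∧ Set.InjOn τ (Bianchi.K32 : Set Bianchi.Gamma32)) ∧
    Bianchi.IsVirtuallyFreeProduct Bianchi.P :=
  ⟨⟨Bianchi.tau, Bianchi.tau_surjective, Bianchi.tau_injOn⟩, Bianchi.isVirtuallyFreeProduct_P⟩
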